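/- Let $T$ be a topological semigroup with neutral element $e$, let $X$ be a non-empty compact Hausdorff space, and let $T\times X\to X$, $(t,x)\mapsto tx$, be a semiflow, i.e. a jointly continuous map with $ex=x$ and $(ts)x=t(sx)$ for all $s,t\in T$, $x\in X$. Suppose that (a) $T$ is a right C-semigroup: for every $s\in T$ the set $T\setminus Ts$ is relatively compact (has compact closure) in $T$; (b) $(T,X)$ is minimal: every orbit $Tx=\{tx : t\in T\}$, $x\in X$, is dense in $X$; (c) $(T,X)$ is weakly almost periodic: for every $f\in C(X,\mathbb{R})$ the set $Tf=\{f_t : t\in T\}$, where $f_t(x)=f(tx)$, is relatively compact in $C(X,\mathbb{R})$ with the topology of pointwise convergence; (d) for every $t\in T$ the map $x\mapsto tx$ is a surjection of $X$ onto itself. Then $(T,X)$ is uniquely ergodic: there is exactly one Borel probability measure $\mu$ on $X$ that is invariant, i.e. satisfies $\mu(t^{-1}B)=\mu(B)$ for all $t\in T$ and all Borel sets $B\subseteq X$, where $t^{-1}B=\{x\in X : tx\in B\}$. -/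

import Mathlib

/-- A topological monoid `T` is a *right C-semigroup* if for every `s : T` the complement
`T \ Ts` of the right translate `Ts = {t * s | t : T}` is relatively compact in `T`. -/
def IsRightCSemigroup (T : Type*) [Monoid T] [TopologicalSpace T] : Prop :=
  ∀ s : T, IsCompact (closure (Set.range (fun t : T => t * s))ᶜ)

/-- The set of real continuous functions on `X`. As a subtype of the product `X → ℝ`, it carries
the topology of pointwise convergence. -/
abbrev PointwiseC (X : Type*) [TopologicalSpace X] : Type _ :=
  {f : X → ℝ // Continuous f}

/-- The translate `f_t : x ↦ f (t x)` of a real continuous function `f` on `X`. -/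
def PointwiseC.translate {T X : Type*} [TopologicalSpace X] [Monoid T] [MulAction T X]
    [ContinuousConstSMul T X] (f : PointwiseC X) (t : T) : PointwiseC X :=
  ⟨fun x => f.1 (t • x), f.2.comp (continuous_const_smul t)⟩

/-- `(T, X)` is *weakly almost periodic* if for every real continuous `f` on `X` the set
`Tf = {f_t | t : T}` is relatively compact in the space of real continuous functions with the
topology of pointwise convergence. -/
def IsWeaklyAlmostPeriodic (T X : Type*) [TopologicalSpace X] [Monoid T] [MulAction T X]
    [ContinuousConstSMul T X] : Prop :=
  ∀ f : PointwiseC X,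
    IsCompact (closure (Set.range (fun t : T => f.translate t)))

/-- `(T, X)` is *uniquely ergodic* if there is exactly one Borel probability measure `μ` on `X`
with `μ (t⁻¹ B) = μ B` for all `t : T` and all Borel sets `B`. -/
def IsUniquelyErgodic (T X : Type*) [MeasurableSpace X] [Monoid T] [MulAction T X] : Prop :=
  ∃! μ : MeasureTheory.Measure X,
    MeasureTheory.IsProbabilityMeasure μ ∧ MeasureTheory.SMulInvariantMeasure T X μ

open Set Filter Topology

/-! The semiflow turns out to be equicontinuous, so the pointwise closure of its translations is a
compact group acting transitively on `X`, and Haar measure on that group settles the question.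

Equicontinuity: weak almost periodicity and `PointwiseC.exists_isOpen_oscillation_le` give a
nonempty open `V` on which all translates of `f` oscillate by at most `ε`. Minimality moves `x` into
`V` by some `s`, which controls every `t ∈ Ts` near `x`; the other `t` lie in a compact set, where
joint continuity suffices.

Hence the enveloping semigroup is a compact Hausdorff topological monoid acting jointly
continuously. Surjectivity survives in the closure and forces idempotents to be the identity, which
gives inverses. The image `ν` of Haar measure under an orbit map is invariant, and each invariant
`μ` integrates continuous functions as `ν` does.

Since `X` need not be metrizable nor `μ` regular, this does not yet give `μ = ν`. An open set is
therefore enlarged, at no cost in `ν`-measure, to one saturated under the stabilizer of a single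
continuous function. Its complement is a closed `Gδ`, where `μ` and `ν` can be compared. -/

/-- Closing-off argument: the values of `F` on finite sets are added countably many times, and any
finite set already lives at one stage. -/
theorem exists_countable_forall_finset_mem {α β : Type*} [Countable β]
    (F : Finset (α × β) → α) :
    ∃ S : Set α, S.Countable ∧ ∀ s : Finset (α × β), (∀ e ∈ s, e.1 ∈ S) → F s ∈ S := by
  let step : Set α → Set α := fun S => S ∪ F '' {s | (s : Set (α × β)) ⊆ S ×ˢ univ}
  let S : ℕ → Set α := fun n => step^[n] ∅
  have hsucc : ∀ n, S (n + 1) = step (S n) := fun n => Function.iterate_succ_apply' step n ∅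
  have hmono : Monotone S := monotone_nat_of_le_succ fun n => by
    rw [hsucc]
    exact subset_union_left
  have hcount : ∀ n, (S n).Countable := by
    intro n
    induction n with
    | zero => exact countable_empty
    | succ n ih =>
      rw [hsucc]
      refine ih.union (Countable.image ?_ F)
      have h := countable_ofPred_finite_subset (ih.prod (countable_univ (α := β)))
      refine (h.preimage_of_injOn (f := fun s : Finset (α × β) => (s : Set (α × β)))
        Finset.coe_injective.injOn).mono ?_
      intro s hs
      exact ⟨s.finite_toSet, hs⟩
  refine ⟨⋃ n, S n, countable_iUnion hcount, fun s hs => ?_⟩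
  have h : ∀ᶠ n in atTop, ∀ e ∈ s, e.1 ∈ S n := by
    rw [Filter.eventually_all_finset]
    intro e he
    obtain ⟨n, hn⟩ := mem_iUnion.1 (hs e he)
    filter_upwards [eventually_ge_atTop n] with m hm using hmono hm hn
  obtain ⟨n, hn⟩ := h.exists
  refine mem_iUnion.2 ⟨n + 1, ?_⟩
  rw [hsucc]
  exact Or.inr ⟨s, fun e he => ⟨hn e he, mem_univ _⟩, rfl⟩

/-! ### Oscillation of pointwise compact sets of continuous functions -/

namespace PointwiseC

variable {X : Type*} [TopologicalSpace X]

/-- The set of points at which finitely many continuous functions take values in prescribed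
open intervals with rational endpoints. -/
def rationalBox (s : Finset (PointwiseC X × ℚ × ℚ)) : Set X :=
  {x | ∀ e ∈ s, e.1.1 x ∈ Ioo (e.2.1 : ℝ) e.2.2}

theorem isOpen_rationalBox (s : Finset (PointwiseC X × ℚ × ℚ)) : IsOpen (rationalBox s) := by
  have : rationalBox s = ⋂ e ∈ s, e.1.1 ⁻¹' Ioo (e.2.1 : ℝ) e.2.2 := by
    ext x
    simp [rationalBox]
  rw [this]
  exact isOpen_biInter_finset fun e _ => isOpen_Ioo.preimage e.1.2

/-- The joint evaluation map of a family of functions. -/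
def evalOn (S : Set (PointwiseC X)) (x : X) : S → ℝ := fun f => f.1.1 x

theorem continuous_evalOn (S : Set (PointwiseC X)) : Continuous (evalOn S) :=
  continuous_pi fun f => f.1.2

theorem continuous_eval_apply (x : X) : Continuous fun f : PointwiseC X => f.1 x :=
  (continuous_apply x).comp continuous_subtype_val

theorem eq_of_evalOn_eq {S : Set (PointwiseC X)} {x y : X} (h : evalOn S x = evalOn S y)
    {f : PointwiseC X} (hf : f ∈ closure S) : f.1 x = f.1 y := by
  have hc : IsClosed {f : PointwiseC X | f.1 x = f.1 y} :=
    isClosed_eq (continuous_eval_apply x) (continuous_eval_apply y)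
  exact closure_minimal (fun g hg => congrFun h ⟨g, hg⟩) hc hf

theorem exists_rationalBox_subset {S : Set (PointwiseC X)} {O : Set (S → ℝ)} (hO : IsOpen O)
    {x : X} (hx : evalOn S x ∈ O) :
    ∃ s : Finset (PointwiseC X × ℚ × ℚ), (∀ e ∈ s, e.1 ∈ S) ∧ x ∈ rationalBox s ∧
      rationalBox s ⊆ evalOn S ⁻¹' O := by
  classical
  obtain ⟨I, u, hu, hsub⟩ := isOpen_pi_iff.1 hO _ hx
  have key : ∀ f : S, ∃ p q : ℚ, f ∈ I → evalOn S x f ∈ Ioo (p : ℝ) q ∧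
      Ioo (p : ℝ) q ⊆ u f := by
    intro f
    by_cases hf : f ∈ I
    · obtain ⟨l, r, hlr, hs⟩ := mem_nhds_iff_exists_Ioo_subset.1 ((hu f hf).1.mem_nhds (hu f hf).2)
      obtain ⟨p, hp1, hp2⟩ := exists_rat_btwn hlr.1
      obtain ⟨q, hq1, hq2⟩ := exists_rat_btwn hlr.2
      exact ⟨p, q, fun _ => ⟨⟨hp2, hq1⟩, (Ioo_subset_Ioo hp1.le hq2.le).trans hs⟩⟩
    · exact ⟨0, 0, fun h => absurd h hf⟩
  choose p q hpq using key
  refine ⟨I.image fun f => (f.1, p f, q f), ?_, ?_, ?_⟩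
  · intro e he
    obtain ⟨f, -, rfl⟩ := Finset.mem_image.1 he
    exact f.2
  · intro e he
    obtain ⟨f, hf, rfl⟩ := Finset.mem_image.1 he
    exact (hpq f hf).1
  · intro y hy
    refine hsub fun f hf => (hpq f hf).2 (hy (f.1, p f, q f) ?_)
    exact Finset.mem_image.2 ⟨f, hf, rfl⟩

variable [CompactSpace X]

/-- Functions in the closure factor continuously through the image of `evalOn S`, a separable
quotient of `X`. Their values over a countable dense subset determine them, so the compact closure
embeds in a countable power of `ℝ`. -/
theorem secondCountableTopology_closure {S : Set (PointwiseC X)} (hS : S.Countable)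
    (hc : IsCompact (closure S)) : SecondCountableTopology (closure S) := by
  have := hS.to_subtype
  have := isCompact_iff_compactSpace.1 hc
  let φ : X → range (evalOn S) := rangeFactorization (evalOn S)
  have hφ : Continuous φ := (continuous_evalOn S).subtype_mk _
  have hφs : Function.Surjective φ := rangeFactorization_surjective
  obtain ⟨D, hD, hDd⟩ := TopologicalSpace.exists_countable_dense (range (evalOn S))
  have := hD.to_subtype
  let ψ : closure S → (D → ℝ) := fun f d => f.1.1 (Function.surjInv hφs d.1)
  have hψ : Continuous ψ :=
    continuous_pi fun d => (continuous_eval_apply _).comp continuous_subtype_val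
  have hinj : Function.Injective ψ := by
    intro f g hfg
    have hsat : ∀ h ∈ closure S, ∀ x, h.1 (Function.surjInv hφs (φ x)) = h.1 x := by
      intro h hh x
      refine eq_of_evalOn_eq ?_ hh
      exact congrArg Subtype.val (Function.surjInv_eq hφs (φ x))
    have hq : IsQuotientMap φ := hφ.isClosedMap.isQuotientMap hφ hφs
    have hcont : ∀ h ∈ closure S, Continuous fun z => h.1 (Function.surjInv hφs z) := by
      intro h hh
      rw [hq.continuous_iff]
      exact h.2.congr fun x => (hsat h hh x).symm
    have heq := (hcont f.1 f.2).ext_on hDd (hcont g.1 g.2) fun d hd => congrFun hfg ⟨d, hd⟩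
    refine Subtype.ext (Subtype.ext (funext fun x => ?_))
    rw [← hsat f.1 f.2, ← hsat g.1 g.2]
    exact congrFun heq (φ x)
  exact (hψ.isClosedEmbedding hinj).isEmbedding.secondCountableTopology

/-- Baire category in the compact image of `evalOn S`: points of `X` are elements of the separable
space `C(closure S, ℝ)`, so countably many closed `ε / 2`-balls cover. The open set is a box built
from `S` alone, which the reduction to countable families needs. -/
theorem exists_rationalBox_oscillation_le [Nonempty X] {S : Set (PointwiseC X)}
    (hS : S.Countable) (hc : IsCompact (closure S)) {ε : ℝ} (hε : 0 < ε) :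
    ∃ s : Finset (PointwiseC X × ℚ × ℚ), (∀ e ∈ s, e.1 ∈ S) ∧ (rationalBox s).Nonempty ∧
      ∀ f ∈ S, ∀ x ∈ rationalBox s, ∀ y ∈ rationalBox s, |f.1 x - f.1 y| ≤ ε := by
  have := hS.to_subtype
  have := isCompact_iff_compactSpace.1 hc
  have := secondCountableTopology_closure hS hc
  let φ : X → range (evalOn S) := rangeFactorization (evalOn S)
  have hφ : Continuous φ := (continuous_evalOn S).subtype_mk _
  have hφs : Function.Surjective φ := rangeFactorization_surjective
  have : CompactSpace (range (evalOn S)) :=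
    isCompact_iff_compactSpace.1 (isCompact_range (continuous_evalOn S))
  have : Nonempty (range (evalOn S)) := ⟨φ (Classical.arbitrary X)⟩
  let ev : X → C(closure S, ℝ) := fun x =>
    ⟨fun f => f.1.1 x, (continuous_eval_apply x).comp continuous_subtype_val⟩
  let g : ℕ → C(closure S, ℝ) := TopologicalSpace.denseSeq _
  let K : ℕ → Set X := fun n => {x | ∀ f : closure S, |f.1.1 x - g n f| ≤ ε / 2}
  have hK : ∀ n, IsClosed (K n) := by
    intro n
    have : K n = ⋂ f : closure S, {x | |f.1.1 x - g n f| ≤ ε / 2} := by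
      ext x
      simp [K]
    rw [this]
    exact isClosed_iInter fun f =>
      isClosed_le (f.1.2.sub continuous_const).abs continuous_const
  have hcover : ⋃ n, φ '' K n = univ := by
    refine eq_univ_of_forall fun z => ?_
    obtain ⟨x, rfl⟩ := hφs z
    obtain ⟨n, hn⟩ := (TopologicalSpace.denseRange_denseSeq C(closure S, ℝ)).exists_dist_lt
      (ev x) (half_pos hε)
    refine mem_iUnion.2 ⟨n, x, fun f => ?_, rfl⟩
    exact ((ContinuousMap.dist_apply_le_dist (f := ev x) (g := g n) f).trans_lt hn).le
  obtain ⟨n, z, hz⟩ := nonempty_interior_of_iUnion_of_closed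
    (fun n => ((hK n).isCompact.image hφ).isClosed) hcover
  obtain ⟨O, hO, hOeq⟩ := isOpen_induced_iff.1 (isOpen_interior (s := φ '' K n))
  obtain ⟨x₀, rfl⟩ := hφs z
  have hx₀ : evalOn S x₀ ∈ O := by
    rw [← hOeq] at hz
    exact hz
  obtain ⟨s, hsS, hxs, hsub⟩ := exists_rationalBox_subset hO hx₀
  have hsK : ∀ x ∈ rationalBox s, ∀ f : closure S, |f.1.1 x - g n f| ≤ ε / 2 := by
    intro x hx f
    have h1 : φ x ∈ interior (φ '' K n) := by
      rw [← hOeq]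
      exact hsub hx
    -- `x` itself is not known to lie in `K n`, but it has the same evaluations as some `y ∈ K n`.
    obtain ⟨y, hy, hxy⟩ := interior_subset h1
    rw [← eq_of_evalOn_eq (congrArg Subtype.val hxy) f.2]
    exact hy f
  refine ⟨s, hsS, ⟨x₀, hxs⟩, fun f hf x hx y hy => ?_⟩
  have h1 := abs_le.1 (hsK x hx ⟨f, subset_closure hf⟩)
  have h2 := abs_le.1 (hsK y hy ⟨f, subset_closure hf⟩)
  exact abs_le.2 ⟨by linarith, by linarith⟩

/-- A compact set of continuous functions, for the topology of pointwise convergence on a compact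
space, has arbitrarily small uniform oscillation on some nonempty open set. -/
theorem exists_isOpen_oscillation_le [Nonempty X] {A : Set (PointwiseC X)} (hA : IsCompact A)
    {ε : ℝ} (hε : 0 < ε) :
    ∃ V : Set X, IsOpen V ∧ V.Nonempty ∧
      ∀ f ∈ A, ∀ x ∈ V, ∀ y ∈ V, |f.1 x - f.1 y| ≤ ε := by
  by_contra! hcon
  obtain ⟨f₀, hf₀, -⟩ := hcon univ isOpen_univ univ_nonempty
  have key : ∀ s : Finset (PointwiseC X × ℚ × ℚ), ∃ f ∈ A, (rationalBox s).Nonempty →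
      ∃ x ∈ rationalBox s, ∃ y ∈ rationalBox s, ε < |f.1 x - f.1 y| := by
    intro s
    by_cases hs : (rationalBox s).Nonempty
    · obtain ⟨f, hf, h⟩ := hcon _ (isOpen_rationalBox s) hs
      exact ⟨f, hf, fun _ => h⟩
    · exact ⟨f₀, hf₀, fun h => absurd h hs⟩
  choose F hFA hF using key
  -- With `S` closed under `F`, the good box found for `S ∩ A` has its own bad function `F s` in `S
  -- ∩ A`.
  obtain ⟨S, hS, hSF⟩ := exists_countable_forall_finset_mem F
  have hS' : (S ∩ A).Countable := hS.mono inter_subset_left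
  have hcl : closure (S ∩ A) ⊆ A := closure_minimal inter_subset_right hA.isClosed
  obtain ⟨s, hsS, hne, hosc⟩ := exists_rationalBox_oscillation_le hS'
    (hA.of_isClosed_subset isClosed_closure hcl) hε
  obtain ⟨x, hx, y, hy, hlt⟩ := hF s hne
  exact (hosc (F s) ⟨hSF s fun e he => (hsS e he).1, hFA s⟩ x hx y hy).not_gt hlt

end PointwiseC

/-! ### Equicontinuity of the semiflow -/

section Equicontinuity

variable {T X : Type*} [Monoid T] [TopologicalSpace T] [TopologicalSpace X] [CompactSpace X]
  [MulAction T X] [ContinuousSMul T X]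

theorem eventually_forall_abs_smul_sub_le (hT : IsRightCSemigroup T)
    (hmin : MulAction.IsMinimal T X) (hwap : IsWeaklyAlmostPeriodic T X)
    {f : X → ℝ} (hf : Continuous f) (x : X) {ε : ℝ} (hε : 0 < ε) :
    ∀ᶠ y in 𝓝 x, ∀ t : T, |f (t • y) - f (t • x)| ≤ ε := by
  have : Nonempty X := ⟨x⟩
  obtain ⟨V, hVo, hVne, hV⟩ := PointwiseC.exists_isOpen_oscillation_le (hwap ⟨f, hf⟩) hε
  obtain ⟨s, hs⟩ := hVo.exists_smul_mem T x hVne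
  have h1 : ∀ᶠ y in 𝓝 x, s • y ∈ V :=
    (continuous_const_smul s).continuousAt.eventually (hVo.mem_nhds hs)
  have h2 : ∀ᶠ y in 𝓝 x, ∀ t ∈ closure (range fun t : T => t * s)ᶜ,
      |f (t • y) - f (t • x)| < ε := by
    refine (hT s).eventually_forall_of_forall_eventually fun t _ => ?_
    have hc : Continuous fun p : X × T => |f (p.2 • p.1) - f (p.2 • x)| := by fun_prop
    refine hc.continuousAt.eventually (Iio_mem_nhds ?_)
    simpa using hε
  filter_upwards [h1, h2] with y hy1 hy2 t
  by_cases ht : t ∈ range fun t : T => t * s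
  · obtain ⟨r, rfl⟩ := ht
    simp only [mul_smul]
    exact hV (PointwiseC.translate ⟨f, hf⟩ r) (subset_closure ⟨r, rfl⟩) _ hy1 _ hs
  · exact (hy2 t (subset_closure ht)).le

end Equicontinuity

/-! ### The enveloping semigroup as a compact group -/

/-- The enveloping semigroup of an action: the closure of the set of translations in the space of
all self-maps, with the topology of pointwise convergence. -/
abbrev EnvelopingMonoid (T X : Type*) [Monoid T] [TopologicalSpace X] [MulAction T X] : Type _ :=
  {p : X → X // p ∈ closure (range fun (t : T) (x : X) => t • x)}

namespace EnvelopingMonoid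

section Algebra

variable {T X : Type*} [Monoid T] [TopologicalSpace X] [MulAction T X]

/-- The translation by an element of the acting monoid. -/
def of (t : T) : EnvelopingMonoid T X := ⟨fun x => t • x, subset_closure ⟨t, rfl⟩⟩

theorem denseRange_of : DenseRange (of : T → EnvelopingMonoid T X) := by
  intro p
  rw [closure_subtype, ← range_comp]
  exact p.2

instance [CompactSpace X] : CompactSpace (EnvelopingMonoid T X) :=
  isCompact_iff_compactSpace.1 isClosed_closure.isCompact

variable [ContinuousConstSMul T X]

/-- Composition is pointwise continuous in the left factor always, but in the right factor only when
the left one is a continuous map. So the limit in `q` is taken first, with the left factor in `T`.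
-/
theorem comp_mem {p q : X → X} (hp : p ∈ closure (range fun (t : T) (x : X) => t • x))
    (hq : q ∈ closure (range fun (t : T) (x : X) => t • x)) :
    p ∘ q ∈ closure (range fun (t : T) (x : X) => t • x) := by
  have h1 : ∀ t : T, (fun x => t • q x) ∈ closure (range fun (t : T) (x : X) => t • x) := by
    intro t
    have hc : Continuous fun (r : X → X) (x : X) => t • r x :=
      continuous_pi fun x => (continuous_apply x).const_smul t
    refine map_mem_closure hc hq ?_
    rintro _ ⟨s, rfl⟩
    exact ⟨t * s, funext fun x => mul_smul t s x⟩
  have hc : Continuous fun (r : X → X) (x : X) => r (q x) :=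
    continuous_pi fun x => continuous_apply (q x)
  change (fun (r : X → X) (x : X) => r (q x)) p ∈ _
  refine closure_closure.subset (map_mem_closure hc hp ?_)
  rintro _ ⟨t, rfl⟩
  exact h1 t

instance : Monoid (EnvelopingMonoid T X) where
  mul p q := ⟨p.1 ∘ q.1, comp_mem p.2 q.2⟩
  one := ⟨id, subset_closure ⟨1, funext fun x => one_smul T x⟩⟩
  mul_assoc _ _ _ := rfl
  one_mul _ := rfl
  mul_one _ := rfl

instance : MulAction (EnvelopingMonoid T X) X where
  smul p x := p.1 x
  one_smul _ := rfl
  mul_smul _ _ _ := rfl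

theorem ext_smul {p q : EnvelopingMonoid T X} (h : ∀ x : X, p • x = q • x) : p = q :=
  Subtype.ext (funext h)

theorem continuous_smul_const (x : X) : Continuous fun p : EnvelopingMonoid T X => p • x :=
  (continuous_apply x).comp continuous_subtype_val

theorem continuousMul [ContinuousSMul (EnvelopingMonoid T X) X] :
    ContinuousMul (EnvelopingMonoid T X) := by
  refine ⟨Continuous.subtype_mk (continuous_pi fun x => ?_) _⟩
  have : Continuous fun p : EnvelopingMonoid T X × EnvelopingMonoid T X => p.1 • p.2 • x :=
    continuous_fst.smul ((continuous_smul_const x).comp continuous_snd)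
  exact this

end Algebra

section Topology

variable {T X : Type*} [Monoid T] [TopologicalSpace T] [TopologicalSpace X] [CompactSpace X]
  [T2Space X] [MulAction T X] [ContinuousSMul T X]

/-- The equicontinuity bound is a closed condition on the translation, so it passes from `T` to its
closure. For a Urysohn function that is 0 at `p • x` and 1 off `W`, moving `p` and moving `x` cost
at most 1/3 each, too little to leave `W`. -/
theorem continuousSMul (hT : IsRightCSemigroup T)
    (hmin : MulAction.IsMinimal T X) (hwap : IsWeaklyAlmostPeriodic T X) :
    ContinuousSMul (EnvelopingMonoid T X) X := by
  refine ⟨continuous_iff_continuousAt.2 fun ⟨p, x⟩ => ?_⟩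
  intro U hU
  obtain ⟨W, hWU, hWo, hpW⟩ := mem_nhds_iff.1 hU
  obtain ⟨f, hf0, hf1, -⟩ := exists_continuous_zero_one_of_isClosed
    (isClosed_singleton (x := p • x)) hWo.isClosed_compl
    (disjoint_compl_right_iff_subset.2 (singleton_subset_iff.2 hpW))
  have h1 : ∀ᶠ y in 𝓝 x, ∀ q : EnvelopingMonoid T X, |f (q • y) - f (q • x)| ≤ 1 / 3 := by
    filter_upwards [eventually_forall_abs_smul_sub_le hT hmin hwap f.continuous x
      (by norm_num : (0 : ℝ) < 1 / 3)] with y hy q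
    have hcl : IsClosed {q : EnvelopingMonoid T X | |f (q • y) - f (q • x)| ≤ 1 / 3} :=
      isClosed_le (((f.continuous.comp (continuous_smul_const y)).sub
        (f.continuous.comp (continuous_smul_const x))).abs) continuous_const
    exact denseRange_of.induction_on q hcl hy
  have h2 : ∀ᶠ q in 𝓝 p, |f (q • x)| < 1 / 3 := by
    have hc : Continuous fun q : EnvelopingMonoid T X => |f (q • x)| :=
      (f.continuous.comp (continuous_smul_const x)).abs
    refine hc.continuousAt.eventually (Iio_mem_nhds ?_)
    simp only
    rw [hf0 rfl]
    norm_num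
  rw [mem_map, nhds_prod_eq]
  filter_upwards [h2.prod_mk h1] with ⟨q, y⟩ ⟨hq, hy⟩
  refine hWU (by_contra fun hn => ?_)
  have h3 : f (q • y) = 1 := hf1 hn
  have h4 := abs_le.1 (hy q)
  have h5 := abs_lt.1 hq
  simp only at h4 h5
  linarith

theorem surjective_smul [ContinuousSMul (EnvelopingMonoid T X) X]
    (hsurj : ∀ t : T, Function.Surjective fun x : X => t • x) (p : EnvelopingMonoid T X) :
    Function.Surjective fun x : X => p • x := by
  intro y
  have hcl : IsClosed {q : EnvelopingMonoid T X | ∃ x : X, q • x = y} := by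
    have : {q : EnvelopingMonoid T X | ∃ x : X, q • x = y} =
        Prod.fst '' {z : EnvelopingMonoid T X × X | z.1 • z.2 = y} := by
      ext q
      simp
    rw [this]
    exact (isClosed_eq continuous_smul continuous_const).isCompact.image continuous_fst |>.isClosed
  exact denseRange_of.induction_on p hcl fun t => hsurj t y

/-- The right ideal generated by `p` is a compact subsemigroup, so it contains an idempotent; a
surjective idempotent map is the identity. -/
theorem exists_mul_eq_one [ContinuousSMul (EnvelopingMonoid T X) X]
    (hsurj : ∀ t : T, Function.Surjective fun x : X => t • x) (p : EnvelopingMonoid T X) :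
    ∃ q : EnvelopingMonoid T X, p * q = 1 := by
  have := continuousMul (T := T) (X := X)
  obtain ⟨_, ⟨q, rfl⟩, hq⟩ := exists_idempotent_in_compact_subsemigroup
    (fun r : EnvelopingMonoid T X => continuous_id.mul continuous_const)
    (range fun q => p * q) (range_nonempty _)
    (isCompact_range (continuous_const.mul continuous_id)) (by
      rintro _ ⟨a, rfl⟩ _ ⟨b, rfl⟩
      exact ⟨a * (p * b), by simp only [mul_assoc]⟩)
  refine ⟨q, ext_smul fun x => ?_⟩
  obtain ⟨y, rfl⟩ := surjective_smul hsurj (p * q) x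
  rw [one_smul]
  simp only [← mul_smul] at hq ⊢
  rw [hq]

theorem isUnit [ContinuousSMul (EnvelopingMonoid T X) X]
    (hsurj : ∀ t : T, Function.Surjective fun x : X => t • x) (p : EnvelopingMonoid T X) :
    IsUnit p := by
  obtain ⟨q, hq⟩ := exists_mul_eq_one hsurj p
  obtain ⟨r, hr⟩ := exists_mul_eq_one hsurj q
  have : p = r := left_inv_eq_right_inv hq hr |>.trans rfl
  exact ⟨⟨p, q, hq, this ▸ hr⟩, rfl⟩

theorem exists_smul_eq [ContinuousSMul (EnvelopingMonoid T X) X]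
    (hmin : MulAction.IsMinimal T X) (x y : X) : ∃ p : EnvelopingMonoid T X, p • x = y := by
  have hcl : IsClosed (range fun p : EnvelopingMonoid T X => p • x) :=
    (isCompact_range (continuous_smul_const x)).isClosed
  have hd := hmin.dense_orbit x
  have hsub : MulAction.orbit T x ⊆ range fun p : EnvelopingMonoid T X => p • x := by
    rintro _ ⟨t, rfl⟩
    exact ⟨of t, rfl⟩
  exact closure_minimal hsub hcl (hd y)

end Topology

end EnvelopingMonoid

theorem IsTopologicalGroup.of_compact_of_continuousMul {G : Type*} [Group G] [TopologicalSpace G]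
    [CompactSpace G] [T2Space G] [ContinuousMul G] : IsTopologicalGroup G := by
  refine { continuous_inv := ?_ }
  rw [continuous_iff_isClosed]
  intro s hs
  have : (fun g : G => g⁻¹) ⁻¹' s = Prod.fst '' {z : G × G | z.1 * z.2 = 1 ∧ z.2 ∈ s} := by
    ext g
    constructor
    · intro hg
      exact ⟨(g, g⁻¹), ⟨mul_inv_cancel g, hg⟩, rfl⟩
    · rintro ⟨⟨a, b⟩, ⟨h1, h2⟩, rfl⟩
      change a⁻¹ ∈ s
      rwa [inv_eq_of_mul_eq_one_right h1]
  rw [this]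
  have hc : IsClosed {z : G × G | z.1 * z.2 = 1 ∧ z.2 ∈ s} :=
    (isClosed_eq continuous_mul continuous_const).inter (hs.preimage continuous_snd)
  exact (hc.isCompact.image continuous_fst).isClosed

/-! ### Comparing Borel measures through continuous functions -/

open Set Filter Topology MeasureTheory

section ContinuousIntegrals

variable {X : Type*} [TopologicalSpace X] [CompactSpace X] [MeasurableSpace X] [BorelSpace X]

theorem Continuous.integrable_of_compactSpace {f : X → ℝ} (hf : Continuous f)
    (μ : Measure X) [IsFiniteMeasure μ] : Integrable f μ :=
  hf.integrable_of_hasCompactSupport (HasCompactSupport.of_compactSpace f)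

variable [T2Space X]

/-- Neither measure is assumed regular, so a Urysohn function gives a comparison only across a
closed-in-open pair. -/
theorem measure_le_measure_of_integral_eq {μ ν : Measure X} [IsFiniteMeasure μ]
    [IsFiniteMeasure ν] (h : ∀ f : X → ℝ, Continuous f → ∫ x, f x ∂μ = ∫ x, f x ∂ν)
    {K U : Set X} (hK : IsClosed K) (hU : IsOpen U) (hKU : K ⊆ U) : μ K ≤ ν U := by
  obtain ⟨f, hf0, hf1, hf⟩ := exists_continuous_zero_one_of_isClosed hU.isClosed_compl hK
    (disjoint_compl_left_iff_subset.2 hKU)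
  have h1 : μ.real K ≤ ∫ x, f x ∂μ := by
    rw [← integral_indicator_one hK.measurableSet]
    refine integral_mono ((integrable_const 1).indicator hK.measurableSet)
      (f.continuous.integrable_of_compactSpace μ) fun x => ?_
    by_cases hx : x ∈ K
    · simp [hx, hf1 hx]
    · simpa [hx] using (hf x).1
  have h2 : ∫ x, f x ∂ν ≤ ν.real U := by
    rw [← integral_indicator_one hU.measurableSet]
    refine integral_mono (f.continuous.integrable_of_compactSpace ν)
      ((integrable_const 1).indicator hU.measurableSet) fun x => ?_
    by_cases hx : x ∈ U
    · simpa [hx] using (hf x).2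
    · simp [hx, hf0 hx]
  rw [← ENNReal.toReal_le_toReal (measure_ne_top _ _) (measure_ne_top _ _)]
  exact h1.trans ((h f f.continuous).trans_le h2)

/-- A geometric sum of Urysohn functions, each equal to 1 on one of the compact sets that exhaust
`U` up to a null set. -/
theorem exists_continuous_measure_diff_support_eq_zero (μ : Measure X) [IsFiniteMeasure μ]
    [μ.InnerRegular] {U : Set X} (hU : IsOpen U) :
    ∃ f : X → ℝ, Continuous f ∧ {x | f x ≠ 0} ⊆ U ∧ μ (U \ {x | f x ≠ 0}) = 0 := by
  have hk : ∀ k : ℕ, ∃ K ⊆ U, IsCompact K ∧ μ (U \ K) < ((k : ENNReal) + 1)⁻¹ := fun k =>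
    hU.measurableSet.exists_isCompact_sdiff_lt (measure_ne_top _ _) (by simp)
  choose K hKU hK hμK using hk
  have hu : ∀ k, ∃ f : C(X, ℝ), EqOn f 0 Uᶜ ∧ EqOn f 1 (K k) ∧ ∀ x, f x ∈ Icc (0 : ℝ) 1 :=
    fun k => exists_continuous_zero_one_of_isClosed hU.isClosed_compl (hK k).isClosed
      (disjoint_compl_left_iff_subset.2 (hKU k))
  choose f hf0 hf1 hf using hu
  have hnn : ∀ k x, 0 ≤ (1 / 2 : ℝ) ^ k * f k x := fun k x =>
    mul_nonneg (by positivity) (hf k x).1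
  have hle : ∀ k x, (1 / 2 : ℝ) ^ k * f k x ≤ (1 / 2) ^ k := fun k x =>
    mul_le_of_le_one_right (by positivity) (hf k x).2
  have hsum : ∀ x, Summable fun k => (1 / 2 : ℝ) ^ k * f k x := fun x =>
    Summable.of_nonneg_of_le (hnn · x) (hle · x) summable_geometric_two
  refine ⟨fun x => ∑' k, (1 / 2 : ℝ) ^ k * f k x, ?_, ?_, ?_⟩
  · refine continuous_tsum (fun k => continuous_const.mul (f k).continuous)
      summable_geometric_two fun k x => ?_
    rw [Real.norm_of_nonneg (hnn k x)]
    exact hle k x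
  · intro x hx
    by_contra hxU
    refine hx ?_
    simp [hf0 _ hxU]
  · have hsub : ∀ k, U \ {x | ∑' k, (1 / 2 : ℝ) ^ k * f k x ≠ 0} ⊆ U \ K k := by
      intro k
      refine sdiff_subset_sdiff_right fun x hx => ne_of_gt ?_
      refine (hsum x).tsum_pos (hnn · x) k ?_
      simp [hf1 k hx]
    refine le_antisymm (ENNReal.le_of_forall_pos_le_add ?_ |>.trans_eq (zero_add 0)) zero_le
    intro ε hε _
    obtain ⟨k, hk⟩ := ENNReal.exists_inv_nat_lt (ENNReal.coe_pos.2 hε).ne'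
    rw [zero_add, zero_add]
    refine (measure_mono (hsub k)).trans ((hμK k).le.trans (le_trans ?_ hk.le))
    exact ENNReal.inv_le_inv.2 le_self_add

end ContinuousIntegrals

/-! ### Invariant measures for transitive compact group actions -/

section Group

variable {G X : Type*} [Group G] [TopologicalSpace G] [IsTopologicalGroup G] [CompactSpace G]
  [T2Space G] [TopologicalSpace X] [CompactSpace X] [T2Space X]
  [MeasurableSpace X] [BorelSpace X] [MulAction G X] [ContinuousSMul G X]

omit [IsTopologicalGroup G] [CompactSpace G] [T2Space G] [T2Space X] [MeasurableSpace X]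
  [BorelSpace X] in
theorem eventually_forall_abs_smul_sub_lt {f : X → ℝ} (hf : Continuous f) (g₀ : G) {ε : ℝ}
    (hε : 0 < ε) : ∀ᶠ g in 𝓝 g₀, ∀ x : X, |f (g • x) - f (g₀ • x)| < ε := by
  have h : ∀ᶠ g in 𝓝 g₀, ∀ x ∈ (univ : Set X), |f (g • x) - f (g₀ • x)| < ε := by
    refine isCompact_univ.eventually_forall_of_forall_eventually fun x _ => ?_
    have hc : Continuous fun p : G × X => |f (p.1 • p.2) - f (g₀ • p.2)| := by fun_prop
    refine hc.continuousAt.eventually (Iio_mem_nhds ?_)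
    simpa using hε
  simpa using h

omit [IsTopologicalGroup G] [CompactSpace G] [T2Space G] [T2Space X] in
theorem continuous_integral_smul (μ : Measure X) [IsFiniteMeasure μ] {f : X → ℝ}
    (hf : Continuous f) : Continuous fun g : G => ∫ x, f (g • x) ∂μ := by
  refine continuous_iff_continuousAt.2 fun g₀ => Metric.tendsto_nhds.2 fun ε hε => ?_
  have hδ : 0 < ε / (μ.real univ + 1) := by positivity
  filter_upwards [eventually_forall_abs_smul_sub_lt hf g₀ hδ] with g hg
  have hi : ∀ g : G, Integrable (fun x => f (g • x)) μ := fun g =>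
    (hf.comp (continuous_const_smul g)).integrable_of_compactSpace μ
  rw [Real.dist_eq, ← integral_sub (hi g) (hi g₀)]
  have h := norm_integral_le_of_norm_le_const (μ := μ) (f := fun x => f (g • x) - f (g₀ • x))
    (Eventually.of_forall fun x => (hg x).le)
  refine lt_of_le_of_lt h ?_
  rw [div_mul_eq_mul_div, div_lt_iff₀ (by positivity)]
  nlinarith [measureReal_nonneg (μ := μ) (s := univ)]

omit [IsTopologicalGroup G] [CompactSpace G] [T2Space G] [T2Space X] in
theorem integral_smul_eq_of_dense {ι : Type*} {φ : ι → G} (hφ : DenseRange φ) {μ : Measure X}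
    [IsFiniteMeasure μ]
    (hμ : ∀ i, ∀ s, MeasurableSet s → μ ((fun x => φ i • x) ⁻¹' s) = μ s)
    {f : X → ℝ} (hf : Continuous f) (g : G) : ∫ x, f (g • x) ∂μ = ∫ x, f x ∂μ := by
  refine hφ.induction_on g (isClosed_eq (continuous_integral_smul μ hf) continuous_const) ?_
  intro i
  have hmp : MeasurePreserving (fun x => φ i • x) μ μ :=
    ⟨(continuous_const_smul _).measurable, Measure.ext fun s hs => by
      rw [Measure.map_apply (continuous_const_smul _).measurable hs, hμ i s hs]⟩
  rw [← integral_map (φ := fun x => φ i • x) hmp.measurable.aemeasurable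
    hf.aestronglyMeasurable_of_compactSpace, hmp.map_eq]

omit [T2Space X] in
/-- A compact group acting continuously and transitively carries a regular invariant probability
measure on the space, with respect to which integrals are averages over orbits. -/
theorem exists_invariant_probability_of_compact_group [Nonempty X]
    [MulAction.IsPretransitive G X] :
    ∃ ν : Measure X, IsProbabilityMeasure ν ∧ ν.InnerRegular ∧
      (∀ g : G, ∀ s, MeasurableSet s → ν ((fun x => g • x) ⁻¹' s) = ν s) ∧
      ∀ μ : Measure X, IsProbabilityMeasure μ →
        (∀ g : G, ∀ f : X → ℝ, Continuous f → ∫ x, f (g • x) ∂μ = ∫ x, f x ∂μ) →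
        ∀ f : X → ℝ, Continuous f → ∫ x, f x ∂μ = ∫ x, f x ∂ν := by
  borelize G
  let h : Measure G := Measure.haarMeasure ⊤
  have hprob : IsProbabilityMeasure h := ⟨Measure.haarMeasure_self⟩
  let x₀ : X := Classical.arbitrary X
  have horb : ∀ x : X, Continuous fun g : G => g • x := fun x => by fun_prop
  have hright : ∀ k : G, h.map (· * k) = h := by
    intro k
    have : IsProbabilityMeasure (h.map (· * k)) :=
      Measure.isProbabilityMeasure_map (measurable_mul_const k).aemeasurable
    exact Measure.isHaarMeasure_eq_of_isProbabilityMeasure _ _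
  refine ⟨h.map fun g => g • x₀, ?_, ?_, ?_, ?_⟩
  · exact Measure.isProbabilityMeasure_map (horb x₀).measurable.aemeasurable
  · exact Measure.InnerRegular.map_of_continuous (horb x₀)
  · intro g s hs
    have hg : Continuous fun x : X => g • x := continuous_const_smul g
    rw [Measure.map_apply (horb x₀).measurable hs,
      Measure.map_apply (horb x₀).measurable (hg.measurable hs),
      ← measure_preimage_mul h g ((fun k => k • x₀) ⁻¹' s)]
    simp only [preimage_preimage, mul_smul]
  · intro μ hμ hinv f hf
    have hmap : ∀ x : X, ∫ g, f (g • x) ∂h = ∫ y, f y ∂h.map fun g => g • x₀ := by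
      intro x
      obtain ⟨k, rfl⟩ := MulAction.exists_smul_eq G x₀ x
      rw [integral_map (horb x₀).measurable.aemeasurable hf.aestronglyMeasurable_of_compactSpace]
      conv_rhs => rw [← hright k]
      have hfx : Continuous fun g : G => f (g • x₀) := hf.comp (horb x₀)
      rw [integral_map (measurable_mul_const k).aemeasurable
        hfx.aestronglyMeasurable_of_compactSpace]
      simp only [mul_smul]
    -- The inner integral on the left is constant in `g` by invariance of `μ`; the one on the right
    -- is constant in `x` by transitivity and right invariance of Haar measure.
    have hswap : ∫ g, ∫ x, f (g • x) ∂μ ∂h = ∫ x, ∫ g, f (g • x) ∂h ∂μ :=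
      integral_integral_swap_of_hasCompactSupport (f := fun (g : G) (x : X) => f (g • x))
        (hf.comp continuous_smul) (HasCompactSupport.of_compactSpace _)
    simpa [hinv _ f hf, hmap] using hswap

omit [IsTopologicalGroup G] [CompactSpace G] [T2Space G] [CompactSpace X] [T2Space X] in
/-- If `U` is open and `N` is a set of group elements fixing a function whose support fills `U` up
to a null set, then the union of the `N`-translates of `U` is no larger than `U` in measure. -/
theorem measure_setOf_exists_smul_mem_le {ν : Measure X} [IsFiniteMeasure ν] [ν.InnerRegular]
    (hν : ∀ g : G, ∀ s, MeasurableSet s → ν ((fun x => g • x) ⁻¹' s) = ν s)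
    {U : Set X} (hU : IsOpen U) {f : X → ℝ} (hf : Continuous f) (hfU : {x | f x ≠ 0} ⊆ U)
    (hnull : ν (U \ {x | f x ≠ 0}) = 0) {N : Set G} (hN : ∀ n ∈ N, ∀ x, f (n • x) = f x) :
    ν (⋃ n ∈ N, (fun x => n • x) ⁻¹' U) ≤ ν U := by
  have hopen : ∀ n : G, IsOpen ((fun x : X => n • x) ⁻¹' U) := fun n =>
    hU.preimage (continuous_const_smul n)
  have hdiff : ∀ n ∈ N, ν ((fun x => n • x) ⁻¹' U \ U) = 0 := by
    intro n hn
    have hm : MeasurableSet (U \ {x | f x ≠ 0}) :=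
      hU.measurableSet.diff (isOpen_ne_fun hf continuous_const).measurableSet
    rw [← nonpos_iff_eq_zero, ← hnull, ← hν n _ hm]
    refine measure_mono fun x hx => ⟨hx.1, fun h => hx.2 (hfU ?_)⟩
    have h' : f (n • x) ≠ 0 := h
    rwa [hN n hn] at h'
  by_contra! hlt
  -- `N` may be uncountable; inner regularity reduces the union of null excesses to a finite one.
  obtain ⟨K, hKU, hK, hKlt⟩ := (isOpen_biUnion fun n (_ : n ∈ N) => hopen n).measurableSet
    |>.exists_lt_isCompact hlt
  obtain ⟨b, hbN, hb, hKb⟩ := hK.elim_finite_subcover_image (fun n _ => hopen n) hKU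
  have hKU' : ν (K \ U) = 0 := by
    refine measure_mono_null (t := ⋃ n ∈ b, (fun x => n • x) ⁻¹' U \ U) ?_
      ((measure_biUnion_null_iff hb.countable).2 fun n hn => hdiff n (hbN hn))
    intro x hx
    obtain ⟨n, hn, hxn⟩ := mem_iUnion₂.1 (hKb hx.1)
    exact mem_iUnion₂.2 ⟨n, hn, hxn, hx.2⟩
  refine hKlt.not_ge ?_
  calc ν K ≤ ν (U ∪ K \ U) := measure_mono fun x hx => by
        by_cases hxU : x ∈ U
        · exact Or.inl hxU
        · exact Or.inr ⟨hx, hxU⟩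
    _ ≤ ν U + ν (K \ U) := measure_union_le _ _
    _ = ν U := by rw [hKU', add_zero]

omit [T2Space G] in
/-- For the invariant measure of a transitive action of a compact group, the complement of an
orbit of an open set under the stabilizer of a continuous function is a closed `Gδ`, on which Borel
measures with the same integrals of continuous functions can be compared. -/
theorem measure_compl_iUnion_smul_preimage_le [MulAction.IsPretransitive G X]
    {μ ν : Measure X} [IsFiniteMeasure μ] [IsFiniteMeasure ν]
    (h : ∀ f : X → ℝ, Continuous f → ∫ x, f x ∂ν = ∫ x, f x ∂μ)
    {U : Set X} (hU : IsOpen U) {f : X → ℝ} (hf : Continuous f) :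
    ν (⋃ n ∈ {n : G | ∀ x, f (n • x) = f x}, (fun x => n • x) ⁻¹' U)ᶜ ≤
      μ (⋃ n ∈ {n : G | ∀ x, f (n • x) = f x}, (fun x => n • x) ⁻¹' U)ᶜ := by
  set N : Set G := {n : G | ∀ x, f (n • x) = f x}
  set C : Set X := (⋃ n ∈ N, (fun x => n • x) ⁻¹' U)ᶜ with hCdef
  have hC : IsClosed C := (isOpen_biUnion fun n (_ : n ∈ N) =>
    hU.preimage (continuous_const_smul n)).isClosed_compl
  have hCmem : ∀ y, y ∈ C ↔ ∀ n ∈ N, n • y ∉ U := by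
    intro y
    simp [hCdef]
  -- The closed sets `P k` shrink to `N`. The sets `D k = P k • C` are closed, contain the open
  -- neighbourhoods `V k` of `C`, and shrink to `C` because `C` is `N`-invariant.
  let P : ℕ → Set G := fun k => {g | ∀ x, |f (g • x) - f x| ≤ 1 / ((k : ℝ) + 1)}
  let O : ℕ → Set G := fun k => interior (P k)
  have hP : ∀ k, IsClosed (P k) := by
    intro k
    have : P k = ⋂ x : X, {g : G | |f (g • x) - f x| ≤ 1 / ((k : ℝ) + 1)} := by
      ext g
      simp [P]
    rw [this]
    refine isClosed_iInter fun x => isClosed_le ?_ continuous_const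
    fun_prop
  have hPanti : Antitone P := fun i j hij g hg x =>
    (hg x).trans (Nat.one_div_le_one_div hij)
  have hO : ∀ k, (1 : G) ∈ O k := by
    intro k
    rw [mem_interior_iff_mem_nhds]
    filter_upwards [eventually_forall_abs_smul_sub_lt (X := X) hf (1 : G)
      (Nat.one_div_pos_of_nat (α := ℝ) (n := k))] with g hg x
    simpa using (hg x).le
  let E : X → ℕ → Set (G × X) := fun y k => {p | p.1 ∈ P k ∧ p.2 ∈ C ∧ p.1 • p.2 = y}
  have hE : ∀ y k, IsClosed (E y k) := fun y k =>
    ((hP k).preimage continuous_fst).inter ((hC.preimage continuous_snd).inter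
      (isClosed_eq continuous_smul continuous_const))
  let D : ℕ → Set X := fun k => {y | (E y k).Nonempty}
  have hDeq : ∀ k, D k = (fun p : G × X => p.1 • p.2) '' (P k ×ˢ C) := by
    intro k
    ext y
    constructor
    · rintro ⟨p, h1, h2, h3⟩
      exact ⟨p, ⟨h1, h2⟩, h3⟩
    · rintro ⟨p, ⟨h1, h2⟩, h3⟩
      exact ⟨p, h1, h2, h3⟩
  have hD : ∀ k, IsClosed (D k) := by
    intro k
    rw [hDeq]
    exact (((hP k).prod hC).isCompact.image continuous_smul).isClosed
  have hDanti : Antitone D := fun i j hij y ⟨p, h1, h2⟩ => ⟨p, hPanti hij h1, h2⟩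
  have hDC : ⋂ k, D k ⊆ C := by
    intro y hy
    -- Compactness yields one pair `(g, c)` that works for all `k`, which puts `g` in `N`.
    obtain ⟨⟨g, c⟩, hgc⟩ := IsCompact.nonempty_iInter_of_sequence_nonempty_isCompact_isClosed
      (E y) (fun k p ⟨h1, h2⟩ => ⟨hPanti k.le_succ h1, h2⟩) (fun k => mem_iInter.1 hy k)
      (hE y 0).isCompact (hE y)
    have hgc' := fun k => mem_iInter.1 hgc k
    have hgN : g ∈ N := by
      intro x
      refine eq_of_abs_sub_nonpos (ge_of_tendsto' tendsto_one_div_add_atTop_nhds_zero_nat ?_)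
      exact fun k => (hgc' k).1 x
    obtain ⟨-, hc, rfl⟩ := hgc' 0
    rw [hCmem] at hc ⊢
    intro n hn
    rw [← mul_smul]
    refine hc (n * g) fun x => ?_
    rw [mul_smul, hn, hgN]
  let V : ℕ → Set X := fun k => ⋃ c ∈ C, (fun g : G => g • c) '' O k
  have hV : ∀ k, IsOpen (V k) := fun k => isOpen_biUnion fun c _ =>
    isOpenMap_smul_of_sigmaCompact c _ isOpen_interior
  have hCV : ∀ k, C ⊆ V k := fun k c hc => mem_iUnion₂.2 ⟨c, hc, 1, hO k, one_smul G c⟩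
  have hVD : ∀ k, V k ⊆ D k := by
    intro k y hy
    obtain ⟨c, hc, g, hg, hgy⟩ := mem_iUnion₂.1 hy
    exact ⟨(g, c), interior_subset hg, hc, hgy⟩
  have hlim := tendsto_measure_iInter_atTop (μ := μ)
    (fun k => (hD k).measurableSet.nullMeasurableSet) hDanti ⟨0, measure_ne_top _ _⟩
  refine (ge_of_tendsto' hlim fun k => ?_).trans (measure_mono hDC)
  exact (measure_le_measure_of_integral_eq h hC (hV k) (hCV k)).trans (measure_mono (hVD k))

/-- A continuous transitive action of a compact group has exactly one Borel probability measure,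
regular or not, which is invariant under a dense set of translations. -/
theorem existsUnique_invariant_probability_of_compact_group [Nonempty X]
    [MulAction.IsPretransitive G X] {ι : Type*} {φ : ι → G} (hφ : DenseRange φ) :
    ∃! μ : Measure X, IsProbabilityMeasure μ ∧
      ∀ i, ∀ s, MeasurableSet s → μ ((fun x => φ i • x) ⁻¹' s) = μ s := by
  obtain ⟨ν, hνp, hνr, hν, huniq⟩ := exists_invariant_probability_of_compact_group (G := G) (X := X)
  refine ⟨ν, ⟨hνp, fun i => hν (φ i)⟩, ?_⟩
  rintro μ ⟨hμp, hμ⟩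
  have hint := huniq μ hμp fun g f hf => integral_smul_eq_of_dense hφ hμ hf g
  have hle : ∀ U : Set X, IsOpen U → μ U ≤ ν U := by
    intro U hU
    obtain ⟨f, hf, hfU, hnull⟩ := exists_continuous_measure_diff_support_eq_zero ν hU
    let N : Set G := {n | ∀ x, f (n • x) = f x}
    let U' : Set X := ⋃ n ∈ N, (fun x => n • x) ⁻¹' U
    have hU' : IsOpen U' := isOpen_biUnion fun n _ => hU.preimage (continuous_const_smul n)
    have hUU' : U ⊆ U' := fun x hx => mem_iUnion₂.2 ⟨1, fun y => by rw [one_smul], by simpa⟩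
    have h1 : ν U'ᶜ ≤ μ U'ᶜ := measure_compl_iUnion_smul_preimage_le
      (fun f hf => (hint f hf).symm) hU hf
    have h2 : ν U' ≤ ν U := measure_setOf_exists_smul_mem_le hν hU hf hfU hnull fun n hn => hn
    have h3 : μ U' ≤ ν U' := by
      rw [← compl_compl U', prob_compl_eq_one_sub hU'.measurableSet.compl,
        prob_compl_eq_one_sub hU'.measurableSet.compl]
      exact tsub_le_tsub_left h1 1
    exact (measure_mono hUU').trans (h3.trans h2)
  -- Inner regularity of `ν` suffices here; it is unavailable for `μ`, hence the detour through `U'`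
  -- in `hle`.
  have hge : ∀ U : Set X, IsOpen U → ν U ≤ μ U := by
    intro U hU
    by_contra! hlt
    obtain ⟨K, hKU, hK, hKlt⟩ := hU.measurableSet.exists_lt_isCompact hlt
    exact hKlt.not_ge
      (measure_le_measure_of_integral_eq (fun f hf => (hint f hf).symm) hK.isClosed hU hKU)
  exact ext_of_generate_finite _ (BorelSpace.measurable_eq (α := X)) isPiSystem_isOpen
    (fun U hU => le_antisymm (hle U hU) (hge U hU)) (by simp)

end Group

theorem mainTheorem11 {T X : Type*} [Monoid T] [TopologicalSpace T] [ContinuousMul T]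
    [TopologicalSpace X] [CompactSpace X] [T2Space X] [Nonempty X]
    [MeasurableSpace X] [BorelSpace X]
    [MulAction T X] [ContinuousSMul T X]
    (hT : IsRightCSemigroup T)
    (hmin : MulAction.IsMinimal T X)
    (hwap : IsWeaklyAlmostPeriodic T X)
    (hsurj : ∀ t : T, Function.Surjective (fun x : X => t • x)) :
    IsUniquelyErgodic T X := by
  have := EnvelopingMonoid.continuousSMul hT hmin hwap
  have := EnvelopingMonoid.continuousMul (T := T) (X := X)
  let : Group (EnvelopingMonoid T X) := groupOfIsUnit (EnvelopingMonoid.isUnit hsurj)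
  have : IsTopologicalGroup (EnvelopingMonoid T X) :=
    IsTopologicalGroup.of_compact_of_continuousMul
  have : MulAction.IsPretransitive (EnvelopingMonoid T X) X :=
    ⟨EnvelopingMonoid.exists_smul_eq hmin⟩
  have h := existsUnique_invariant_probability_of_compact_group (X := X)
    (EnvelopingMonoid.denseRange_of (T := T) (X := X))
  simp only [IsUniquelyErgodic, smulInvariantMeasure_iff]
  exact h
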